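/- Let $N\in\mathbb N$ and $p\in\mathbb R$ with $N>p>1$, let $\alpha\in(0,1]$, and put $p^*=\frac{pN}{N-p}$. Let $D^{1,p}(\mathbb R^N)$ be the space of functions $u\in L^{p^*}(\mathbb R^N)$ whose weak gradient $\nabla u$ exists and lies in $L^p(\mathbb R^N;\mathbb R^N)$, and let $C^{1,\alpha}_{loc}(\mathbb R^N)$ be the space of continuously differentiable functions on $\mathbb R^N$ whose gradient is $\alpha$-Hölder continuous on every compact set. Let $g:\mathbb R^N\to(0,\infty)$ and $\hat f:[0,\infty)\to[0,\infty)$ be continuous, with $\hat f(0)=0$ and $\hat f(t)>0$ for $t>0$. Let $u\in D^{1,p}(\mathbb R^N)\cap C^{1,\alpha}_{loc}(\mathbb R^N)$ satisfy $u\ge 0$ in $\mathbb R^N$ and be a weak solution of $-\Delta_p u=g(x)\,\hat f(u)$ in $\mathbb R^N$, that is, $$\int_{\mathbb R^N}|\nabla u|^{p-2}\,\nabla u\cdot\nabla\varphi\,dx=\int_{\mathbb R^N}g(x)\,\hat f(u)\,\varphi\,dx\qquad\text{for all }\varphi\in C_c^\infty(\mathbb R^N),$$ where $|\nabla u|^{p-2}\nabla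 u$ is read as $0$ where $\nabla u=0$. If $$\liminf_{|x|\to\infty}|x|^{(N-p)/(p-1)}\,u(x)=0,$$ then $u(x)=0$ for every $x\in\mathbb R^N$. -/

import Mathlib

open MeasureTheory Filter
open scoped ContDiff ENNReal NNReal

/-- Test functions: the space `C_c^∞(ℝᴺ)`. -/
def IsTestFunction {N : ℕ} (φ : EuclideanSpace ℝ (Fin N) → ℝ) : Prop :=
  ContDiff ℝ ∞ φ ∧ HasCompactSupport φ

/-- `G` is the weak (distributional) gradient of `u` on `ℝᴺ`: both are locally integrable and
`∫ u ∂ᵢφ = - ∫ Gᵢ φ` for all test functions `φ` and all `i`. -/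
def HasWeakGradient {N : ℕ} (u : EuclideanSpace ℝ (Fin N) → ℝ)
    (G : EuclideanSpace ℝ (Fin N) → EuclideanSpace ℝ (Fin N)) : Prop :=
  LocallyIntegrable u ∧ LocallyIntegrable G ∧
    ∀ φ : EuclideanSpace ℝ (Fin N) → ℝ, IsTestFunction φ → ∀ i : Fin N,
      ∫ x, u x * (gradient φ x) i = - ∫ x, (G x) i * φ x

/-- The space `D^{1,p}(ℝᴺ)`, for `1 < p < N`: functions in `L^{p*}`, with `p* = pN/(N-p)`, whose
weak gradient exists and lies in `L^p`. -/
def MemD1p {N : ℕ} (p : ℝ) (u : EuclideanSpace ℝ (Fin N) → ℝ) : Prop :=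
  MemLp u (ENNReal.ofReal (p * N / (N - p))) ∧
    ∃ G : EuclideanSpace ℝ (Fin N) → EuclideanSpace ℝ (Fin N),
      HasWeakGradient u G ∧ MemLp G (ENNReal.ofReal p)

/-- The space `C^{1,α}_loc(ℝᴺ)`: continuously differentiable functions whose derivative is
`α`-Hölder continuous on every compact set. -/
def MemC1alphaLoc {N : ℕ} (α : ℝ≥0) (u : EuclideanSpace ℝ (Fin N) → ℝ) : Prop :=
  ContDiff ℝ 1 u ∧
    ∀ K : Set (EuclideanSpace ℝ (Fin N)), IsCompact K →
      ∃ C : ℝ≥0, HolderOnWith C α (fderiv ℝ u) K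

/-- `u` is a weak solution of `-Δ_p u = F` in `ℝᴺ`: its weak gradient `G` exists, lies in `L^p`,
and `∫ |G|^{p-2} G · ∇φ = ∫ F φ` for all test functions `φ`. (Where `G = 0` the field
`|G|^{p-2} G` is zero, also for `p < 2`.) -/
def IsWeakSolutionPLaplace {N : ℕ} (p : ℝ) (u F : EuclideanSpace ℝ (Fin N) → ℝ) : Prop :=
  ∃ G : EuclideanSpace ℝ (Fin N) → EuclideanSpace ℝ (Fin N),
    HasWeakGradient u G ∧ MemLp G (ENNReal.ofReal p) ∧
      ∀ φ : EuclideanSpace ℝ (Fin N) → ℝ, IsTestFunction φ →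
        ∫ x, ‖G x‖ ^ (p - 2) * inner ℝ (G x) (gradient φ x) = ∫ x, F x * φ x

/-! Since `g * f(u)` is nonnegative, `u` is a nonnegative `p`-superharmonic function; nothing else
about the right-hand side matters. Suppose `u x₀ > 0` and put `γ = (N - p)/(p - 1)`. The barrier `c
* (|x - x₀|^(-γ) - R^(-γ))` is `p`-harmonic off `x₀`, vanishes on the sphere of radius `R`, and for
small `c` lies below `u` on a small sphere about `x₀`. Comparison on the annulus and `R → ∞` give `u
≥ c * |x - x₀|^(-γ)` far out, so the liminf is positive, a contradiction.

`pLaplace_weak_comparison` tests with the square of a positive part, which is `C¹`, so no Sobolev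
theory is needed; mollification extends the inequality from smooth to `C¹` test functions. That the
barrier is `p`-harmonic reduces to `|x|^(-N) x` being divergence-free, because its flux is a
multiple of that field for every `p`. -/

/-! ### Weak and classical gradients -/

theorem gradient_apply_eq_fderiv_single {N : ℕ} (φ : EuclideanSpace ℝ (Fin N) → ℝ)
    (x : EuclideanSpace ℝ (Fin N)) (i : Fin N) :
    (gradient φ x) i = fderiv ℝ φ x (EuclideanSpace.single i 1) := by
  have h := EuclideanSpace.inner_single_right i (1 : ℝ) (gradient φ x)
  rw [inner_gradient_left] at h
  simpa using h.symm

/-- Integration by parts makes the classical gradient a weak one too, so the difference integrates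
to zero against every test function. -/
theorem HasWeakGradient.ae_eq_gradient {N : ℕ} {u : EuclideanSpace ℝ (Fin N) → ℝ}
    {G : EuclideanSpace ℝ (Fin N) → EuclideanSpace ℝ (Fin N)}
    (h : HasWeakGradient u G) (hu : ContDiff ℝ 1 u) : ∀ᵐ x, G x = gradient u x := by
  obtain ⟨-, hG, hw⟩ := h
  have key : ∀ i : Fin N, ∀ᵐ x, G x i - gradient u x i = 0 := by
    intro i
    have hGi : LocallyIntegrable (fun x => G x i) := fun x => by
      obtain ⟨s, hs, hint⟩ := hG x
      exact ⟨s, hs, (EuclideanSpace.proj (𝕜 := ℝ) i).integrable_comp hint⟩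
    have hcu : Continuous (fun x => gradient u x i) := by
      simp only [gradient_apply_eq_fderiv_single]
      exact (hu.continuous_fderiv one_ne_zero).clm_apply continuous_const
    refine ae_eq_zero_of_integral_contDiff_smul_eq_zero (hGi.sub hcu.locallyIntegrable) ?_
    intro φ hφ hφc
    have h1 := hw φ ⟨hφ, hφc⟩ i
    have hcφ : Continuous (fun x => fderiv ℝ φ x (EuclideanSpace.single i 1)) :=
      (hφ.continuous_fderiv (by simp)).clm_apply continuous_const
    have hsφ : HasCompactSupport (fun x => fderiv ℝ φ x (EuclideanSpace.single i 1)) :=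
      hφc.fderiv_apply ℝ _
    have h2 := integral_mul_fderiv_eq_neg_fderiv_mul_of_integrable (μ := volume)
      (f := u) (g := φ) (v := EuclideanSpace.single i 1)
      (by
        simp only [← gradient_apply_eq_fderiv_single u]
        exact (hcu.mul hφ.continuous).integrable_of_hasCompactSupport hφc.mul_left)
      ((hu.continuous.mul hcφ).integrable_of_hasCompactSupport hsφ.mul_left)
      ((hu.continuous.mul hφ.continuous).integrable_of_hasCompactSupport hφc.mul_left)
      (fun x _ => hu.differentiable one_ne_zero x)
      (fun x _ => hφ.differentiable (by simp) x)
    simp only [gradient_apply_eq_fderiv_single φ] at h1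
    rw [h1] at h2
    simp only [smul_eq_mul, mul_sub]
    have i1 : Integrable (fun x => φ x * G x i) := by
      simpa using hGi.integrable_smul_left_of_hasCompactSupport hφ.continuous hφc
    have i2 : Integrable (fun x => φ x * gradient u x i) :=
      (hφ.continuous.mul hcu).integrable_of_hasCompactSupport hφc.mul_right
    rw [integral_sub i1 i2]
    simp only [← gradient_apply_eq_fderiv_single u] at h2
    simp only [mul_comm (φ _)]
    linarith
  filter_upwards [ae_all_iff.2 key] with x hx
  ext i
  linarith [hx i]

/-! ### From smooth to `C¹` test functions -/

section Mollification

variable {E : Type*} [NormedAddCommGroup E] [NormedSpace ℝ E] [FiniteDimensional ℝ E]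
  [MeasurableSpace E] [BorelSpace E] {μ : Measure E} [μ.IsAddHaarMeasure]

/-- Convolve with a narrow bump: the derivative falls on `φ`, and `fderiv ℝ φ` is uniformly
continuous by compact support. -/
theorem exists_contDiff_nonneg_dist_fderiv_le {φ : E → ℝ}
    (hφ : ContDiff ℝ 1 φ) (hφc : HasCompactSupport φ) (hφ0 : ∀ x, 0 ≤ φ x)
    {ε : ℝ} (hε : 0 < ε) :
    ∃ ψ : E → ℝ, ContDiff ℝ ∞ ψ ∧ tsupport ψ ⊆ Metric.cthickening 1 (tsupport φ) ∧ (∀ x, 0 ≤ ψ x) ∧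
      ∀ x, ‖fderiv ℝ ψ x - fderiv ℝ φ x‖ ≤ ε := by
  let ν : Measure E := Measure.addHaar
  have hd : Continuous (fderiv ℝ φ) := hφ.continuous_fderiv one_ne_zero
  obtain ⟨δ, hδ, hδε⟩ := Metric.uniformContinuous_iff.1
    ((hφc.fderiv ℝ).uniformContinuous_of_continuous hd) ε hε
  -- The bound `δ` serves uniform continuity; the bound `1` keeps the support in the unit
  -- thickening.
  let b : ContDiffBump (0 : E) := ⟨min δ 1 / 2, min δ 1, by positivity, by
    have : 0 < min δ 1 := by positivity
    linarith⟩
  let L := ContinuousLinearMap.lsmul ℝ ℝ (E := ℝ)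
  have hfd : ∀ x, HasFDerivAt (convolution (b.normed ν) φ L ν)
      (convolution (b.normed ν) (fderiv ℝ φ) (L.precompR E) ν x) x := fun x =>
    hφc.hasFDerivAt_convolution_right L (b.continuous_normed.locallyIntegrable) hφ x
  refine ⟨convolution (b.normed ν) φ L ν, ?_, ?_, ?_, ?_⟩
  · exact b.hasCompactSupport_normed.contDiff_convolution_left L b.contDiff_normed
      hφ.continuous.locallyIntegrable
  · refine closure_minimal ?_ Metric.isClosed_cthickening
    refine (support_convolution_subset L).trans ?_
    rintro _ ⟨y, hy, z, hz, rfl⟩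
    rw [b.support_normed_eq] at hy
    refine Metric.mem_cthickening_of_dist_le _ z _ _ (subset_tsupport _ hz) ?_
    simp only [dist_eq_norm, add_sub_cancel_right]
    have : ‖y‖ < min δ 1 := mem_ball_zero_iff.1 hy
    exact this.le.trans (min_le_right _ _)
  · intro x
    exact integral_nonneg fun y => mul_nonneg (b.nonneg_normed _) (hφ0 _)
  · intro x
    rw [(hfd x).fderiv]
    have := b.dist_normed_convolution_le (μ := ν) (g := fderiv ℝ φ) (x₀ := x) (ε := ε)
      hd.aestronglyMeasurable (fun y hy => (hδε ?_).le)
    · rwa [dist_eq_norm] at this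
    · exact (Metric.mem_ball.1 hy).trans_le (min_le_left _ _)

theorem integral_fderiv_nonneg_of_forall_contDiff {V : E → E} (hV : Continuous V)
    (h : ∀ φ : E → ℝ, ContDiff ℝ ∞ φ → HasCompactSupport φ → (∀ x, 0 ≤ φ x) →
      0 ≤ ∫ x, fderiv ℝ φ x (V x) ∂μ)
    {φ : E → ℝ} (hφ : ContDiff ℝ 1 φ) (hφc : HasCompactSupport φ) (hφ0 : ∀ x, 0 ≤ φ x) :
    0 ≤ ∫ x, fderiv ℝ φ x (V x) ∂μ := by
  set K := Metric.cthickening 1 (tsupport φ)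
  have hK : IsCompact K := IsCompact.cthickening hφc
  have hint : ∀ ψ : E → ℝ, ContDiff ℝ 1 ψ → tsupport ψ ⊆ K →
      Integrable (fun x => fderiv ℝ ψ x (V x)) μ := by
    intro ψ hψ hs
    refine ((hψ.continuous_fderiv one_ne_zero).clm_apply hV).integrable_of_hasCompactSupport ?_
    refine (HasCompactSupport.fderiv (𝕜 := ℝ) (hK.of_isClosed_subset (isClosed_tsupport _) hs)).mono
      fun x hx hx' => hx ?_
    simp [hx']
  refine le_of_forall_pos_le_add fun ε hε => ?_
  set C := ∫ x in K, ‖V x‖ ∂μ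
  have hC : 0 ≤ C := integral_nonneg fun _ => norm_nonneg _
  -- The `+ 1` guards against `C = 0`.
  obtain ⟨ψ, hψ, hψs, hψ0, hψd⟩ := exists_contDiff_nonneg_dist_fderiv_le hφ hφc hφ0
    (ε := ε / (C + 1)) (by positivity)
  have h1 := h ψ hψ (hK.of_isClosed_subset (isClosed_tsupport _) hψs) hψ0
  have hφs : tsupport φ ⊆ K := Metric.self_subset_cthickening _
  have iψ := hint ψ (hψ.of_le (by simp)) hψs
  have iφ := hint φ hφ hφs
  have hVi : IntegrableOn (fun x => ‖V x‖) K μ := hV.norm.continuousOn.integrableOn_compact hK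
  have h2 : ∫ x, fderiv ℝ ψ x (V x) ∂μ - ∫ x, fderiv ℝ φ x (V x) ∂μ ≤ ε / (C + 1) * C := by
    rw [← integral_sub iψ iφ, ← integral_const_mul, ← integral_indicator hK.measurableSet]
    refine integral_mono (iψ.sub iφ) (IntegrableOn.integrable_indicator (hVi.const_mul _) hK.measurableSet) ?_
    intro x
    by_cases hx : x ∈ K
    · rw [Set.indicator_of_mem hx]
      have := ((fderiv ℝ ψ x - fderiv ℝ φ x).le_opNorm (V x)).trans
        (mul_le_mul_of_nonneg_right (hψd x) (norm_nonneg _))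
      exact (le_abs_self _).trans this
    · rw [Set.indicator_of_notMem hx]
      have z : ∀ χ : E → ℝ, tsupport χ ⊆ K → fderiv ℝ χ x = 0 := fun χ hχ =>
        image_eq_zero_of_notMem_tsupport fun hx' => hx (hχ (tsupport_fderiv_subset ℝ hx'))
      simp [z ψ hψs, z φ hφs]
  have h3 : ε / (C + 1) * C ≤ ε := by
    rw [div_mul_eq_mul_div, div_le_iff₀ (by positivity)]
    nlinarith
  linarith

end Mollification

/-! ### Monotonicity of `a ↦ |a|^(p-2) a`, and powers of the norm -/

section Vector

variable {E : Type*} [NormedAddCommGroup E] [InnerProductSpace ℝ E]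

theorem rpow_sub_two_mul_self {t p : ℝ} (hp : 1 < p) (ht : 0 ≤ t) :
    t ^ (p - 2) * t = t ^ (p - 1) := by
  rcases ht.eq_or_lt with rfl | ht
  · rw [mul_zero, Real.zero_rpow (by linarith)]
  · rw [← Real.rpow_add_one ht.ne']
    ring_nf

theorem continuous_norm_rpow_smul {p : ℝ} (hp : 1 < p) :
    Continuous fun a : E => ‖a‖ ^ (p - 2) • a := by
  rw [continuous_iff_continuousAt]
  intro a
  rcases eq_or_ne a 0 with rfl | ha
  · rw [ContinuousAt, smul_zero, tendsto_zero_iff_norm_tendsto_zero]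
    have h : ∀ a : E, ‖‖a‖ ^ (p - 2) • a‖ = ‖a‖ ^ (p - 1) := fun a => by
      rw [norm_smul, Real.norm_of_nonneg (by positivity), rpow_sub_two_mul_self hp (norm_nonneg _)]
    simp only [h]
    have : Tendsto (fun a : E => ‖a‖ ^ (p - 1)) (nhds 0) (nhds (‖(0 : E)‖ ^ (p - 1))) :=
      continuous_norm.continuousAt.rpow_const (Or.inr (by linarith))
    rwa [norm_zero, Real.zero_rpow (by linarith)] at this
  · exact (continuous_norm.continuousAt.rpow_const (Or.inl (norm_ne_zero_iff.2 ha))).smul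
      continuousAt_id

/-- Splits the monotonicity expression into a radial and an angular term. The first is nonnegative
as `t ^ (p - 1)` increases, the second by Cauchy–Schwarz; if both vanish, the vectors coincide. -/
theorem inner_norm_rpow_smul_sub_eq {p : ℝ} (hp : 1 < p) (a b : E) :
    (‖a‖ ^ (p - 1) - ‖b‖ ^ (p - 1)) * (‖a‖ - ‖b‖)
      + (‖a‖ ^ (p - 2) + ‖b‖ ^ (p - 2)) * (‖a‖ * ‖b‖ - inner ℝ a b)
      = inner ℝ (‖a‖ ^ (p - 2) • a - ‖b‖ ^ (p - 2) • b) (a - b) := by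
  simp only [inner_sub_left, inner_sub_right, inner_smul_left, real_inner_self_eq_norm_sq,
    ← rpow_sub_two_mul_self hp (norm_nonneg _), real_inner_comm a b, RCLike.conj_to_real]
  ring

theorem rpow_sub_mul_sub_nonneg {p s t : ℝ} (hp : 1 < p) (hs : 0 ≤ s) (ht : 0 ≤ t) :
    0 ≤ (s ^ (p - 1) - t ^ (p - 1)) * (s - t) := by
  rcases le_total s t with h | h
  · exact mul_nonneg_of_nonpos_of_nonpos
      (sub_nonpos.2 (Real.rpow_le_rpow hs h (by linarith))) (sub_nonpos.2 h)
  · exact mul_nonneg (sub_nonneg.2 (Real.rpow_le_rpow ht h (by linarith))) (sub_nonneg.2 h)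

theorem inner_norm_rpow_smul_sub_nonneg {p : ℝ} (hp : 1 < p) (a b : E) :
    0 ≤ inner ℝ (‖a‖ ^ (p - 2) • a - ‖b‖ ^ (p - 2) • b) (a - b) := by
  rw [← inner_norm_rpow_smul_sub_eq hp]
  have := real_inner_le_norm a b
  have := rpow_sub_mul_sub_nonneg hp (norm_nonneg a) (norm_nonneg b)
  have : 0 ≤ ‖a‖ ^ (p - 2) + ‖b‖ ^ (p - 2) := by positivity
  nlinarith

theorem eq_of_inner_norm_rpow_smul_sub_eq_zero {p : ℝ} (hp : 1 < p) {a b : E}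
    (h : inner ℝ (‖a‖ ^ (p - 2) • a - ‖b‖ ^ (p - 2) • b) (a - b) = 0) : a = b := by
  rw [← inner_norm_rpow_smul_sub_eq hp] at h
  have h1 := real_inner_le_norm a b
  have h2 := rpow_sub_mul_sub_nonneg hp (norm_nonneg a) (norm_nonneg b)
  have h3 : 0 ≤ ‖a‖ ^ (p - 2) + ‖b‖ ^ (p - 2) := by positivity
  have h4 := mul_nonneg h3 (sub_nonneg.2 h1)
  have h5 : (‖a‖ ^ (p - 1) - ‖b‖ ^ (p - 1)) * (‖a‖ - ‖b‖) = 0 := by linarith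
  have h6 : (‖a‖ ^ (p - 2) + ‖b‖ ^ (p - 2)) * (‖a‖ * ‖b‖ - inner ℝ a b) = 0 := by linarith
  have hn : ‖a‖ = ‖b‖ := by
    rcases mul_eq_zero.1 h5 with h | h
    · exact Real.rpow_left_injOn (by linarith : p - 1 ≠ 0) (norm_nonneg a) (norm_nonneg b)
        (sub_eq_zero.1 h)
    · exact sub_eq_zero.1 h
  rcases eq_or_ne a 0 with rfl | ha
  · exact (norm_eq_zero.1 (hn.symm.trans norm_zero)).symm
  have hpos : 0 < ‖a‖ ^ (p - 2) := Real.rpow_pos_of_pos (norm_pos_iff.2 ha) _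
  have h7 : ‖a‖ * ‖b‖ - inner ℝ a b = 0 :=
    (mul_eq_zero.1 h6).resolve_left (by positivity)
  have h8 : ‖a - b‖ ^ 2 = 0 := by
    rw [norm_sub_sq_real, ← hn]
    rw [← hn] at h7
    linarith
  exact sub_eq_zero.1 (norm_eq_zero.1 (pow_eq_zero_iff two_ne_zero |>.1 h8))

theorem hasFDerivAt_norm_sub_rpow (a : ℝ) {x x₀ : E} (hx : x ≠ x₀) :
    HasFDerivAt (fun y => ‖y - x₀‖ ^ a)
      ((a * ‖x - x₀‖ ^ (a - 2)) • innerSL ℝ (x - x₀)) x := by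
  have hpos : 0 < ‖x - x₀‖ := norm_pos_iff.2 (sub_ne_zero.2 hx)
  have h1 : HasFDerivAt (fun y => ‖y - x₀‖ ^ 2) (2 • innerSL ℝ (x - x₀)) x := by
    have h := HasFDerivAt.comp x (hasStrictFDerivAt_norm_sq (x - x₀)).hasFDerivAt
      (hasFDerivAt_sub_const x₀)
    rwa [ContinuousLinearMap.comp_id] at h
  have h2 := h1.rpow_const (p := a / 2) (Or.inl (by positivity))
  have e : ∀ c : ℝ, ∀ y : E, (‖y - x₀‖ ^ 2) ^ c = ‖y - x₀‖ ^ (2 * c) := fun c y => by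
    rw [← Real.rpow_natCast, ← Real.rpow_mul (norm_nonneg _)]
    norm_num
  simp only [e] at h2
  convert h2 using 1
  · ext y
    ring_nf
  · ext v
    simp only [nsmul_eq_mul, smul_apply, smul_eq_mul]
    rw [show 2 * (a / 2 - 1) = a - 2 by ring]
    push_cast
    ring

end Vector

/-! ### The divergence-free field `|x - x₀|^(-N) (x - x₀)` -/

section Fundamental

variable {N : ℕ}

theorem hasFDerivAt_norm_rpow_mul_coord {x x₀ : EuclideanSpace ℝ (Fin N)} (hx : x ≠ x₀)
    (i : Fin N) :
    HasFDerivAt (fun y => ‖y - x₀‖ ^ (-(N : ℝ)) * (y - x₀) i)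
      (‖x - x₀‖ ^ (-(N : ℝ)) • EuclideanSpace.proj (𝕜 := ℝ) i + (x - x₀) i •
        ((-(N : ℝ) * ‖x - x₀‖ ^ (-(N : ℝ) - 2)) • innerSL ℝ (x - x₀))) x := by
  refine (hasFDerivAt_norm_sub_rpow _ hx).mul ?_
  exact (EuclideanSpace.proj (𝕜 := ℝ) i).hasFDerivAt.comp x
      ((hasFDerivAt_id x).sub_const x₀)

theorem sum_fderiv_norm_rpow_mul_coord {x x₀ : EuclideanSpace ℝ (Fin N)} (hx : x ≠ x₀) :
    ∑ i : Fin N, fderiv ℝ (fun y => ‖y - x₀‖ ^ (-(N : ℝ)) * (y - x₀) i) x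
      (EuclideanSpace.single i 1) = 0 := by
  have hpos : 0 < ‖x - x₀‖ := norm_pos_iff.2 (sub_ne_zero.2 hx)
  have h : ∀ i : Fin N, fderiv ℝ (fun y => ‖y - x₀‖ ^ (-(N : ℝ)) * (y - x₀) i) x
      (EuclideanSpace.single i 1) = ‖x - x₀‖ ^ (-(N : ℝ))
        - N * ‖x - x₀‖ ^ (-(N : ℝ) - 2) * (x - x₀) i ^ 2 := fun i => by
    rw [(hasFDerivAt_norm_rpow_mul_coord hx i).fderiv]
    have := EuclideanSpace.inner_single_right i (1 : ℝ) (x - x₀)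
    simp only [add_apply, smul_apply, smul_eq_mul,
      innerSL_apply_apply, this]
    simp
    ring
  simp only [h, Finset.sum_sub_distrib, ← Finset.mul_sum]
  rw [← EuclideanSpace.real_norm_sq_eq, mul_assoc, ← Real.rpow_natCast, ← Real.rpow_add hpos]
  simp

/-- Integrate by parts coordinatewise; the support of `φ` avoids the singularity, off which the
divergence is zero. -/
theorem integrable_and_integral_fderiv_norm_rpow_smul {x₀ : EuclideanSpace ℝ (Fin N)}
    {φ : EuclideanSpace ℝ (Fin N) → ℝ} (hφ : ContDiff ℝ 1 φ) (hφc : HasCompactSupport φ)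
    (hx₀ : x₀ ∉ tsupport φ) :
    Integrable (fun x => fderiv ℝ φ x (‖x - x₀‖ ^ (-(N : ℝ)) • (x - x₀))) ∧
      ∫ x, fderiv ℝ φ x (‖x - x₀‖ ^ (-(N : ℝ)) • (x - x₀)) = 0 := by
  let V : Fin N → EuclideanSpace ℝ (Fin N) → ℝ := fun i y => ‖y - x₀‖ ^ (-(N : ℝ)) * (y - x₀) i
  have hne : ∀ x ∈ tsupport φ, x ≠ x₀ := fun x hx h => hx₀ (h ▸ hx)
  have hcont : ∀ ψ : EuclideanSpace ℝ (Fin N) → ℝ, tsupport ψ ⊆ tsupport φ →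
      ∀ W : EuclideanSpace ℝ (Fin N) → ℝ, Continuous ψ → (∀ x ≠ x₀, ContinuousAt W x) →
      Integrable (fun x => ψ x * W x) := by
    intro ψ hψs W hψ hW
    have hcs : HasCompactSupport ψ := hφc.of_isClosed_subset (isClosed_tsupport _) hψs
    refine Continuous.integrable_of_hasCompactSupport ?_ hcs.mul_right
    refine continuous_of_tsupport fun x hx => ?_
    exact hψ.continuousAt.mul (hW x (hne x (hψs (tsupport_mul_subset_left hx))))
  have hVd : ∀ i, ∀ x ≠ x₀, ContinuousAt (V i) x := fun i x hx =>
    (hasFDerivAt_norm_rpow_mul_coord hx i).continuousAt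
  have hdec : ∀ x, fderiv ℝ φ x (‖x - x₀‖ ^ (-(N : ℝ)) • (x - x₀)) =
      ∑ i, fderiv ℝ φ x (EuclideanSpace.single i 1) * V i x := fun x => by
    conv_lhs => rw [← (EuclideanSpace.basisFun (Fin N) ℝ).sum_repr
      (‖x - x₀‖ ^ (-(N : ℝ)) • (x - x₀))]
    simp [V, mul_comm]
  have hs : ∀ i, tsupport (fun x => fderiv ℝ φ x (EuclideanSpace.single i 1)) ⊆ tsupport φ :=
    fun i => tsupport_fderiv_apply_subset ℝ _
  have hi : ∀ i, Integrable (fun x => fderiv ℝ φ x (EuclideanSpace.single i 1) * V i x) := fun i =>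
    hcont _ (hs i) _ ((hφ.continuous_fderiv one_ne_zero).clm_apply continuous_const) (hVd i)
  have hi' : ∀ i, Integrable (fun x => φ x * fderiv ℝ (V i) x (EuclideanSpace.single i 1)) := by
    intro i
    refine hcont _ subset_rfl _ hφ.continuous fun x hx => ?_
    have hev : (fun y => fderiv ℝ (V i) y (EuclideanSpace.single i 1)) =ᶠ[nhds x] fun y =>
        (‖y - x₀‖ ^ (-(N : ℝ)) • EuclideanSpace.proj (𝕜 := ℝ) i + (y - x₀) i •
        ((-(N : ℝ) * ‖y - x₀‖ ^ (-(N : ℝ) - 2)) • innerSL ℝ (y - x₀)))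
          (EuclideanSpace.single i 1) := by
      filter_upwards [isOpen_ne.mem_nhds hx] with y hy
      rw [(hasFDerivAt_norm_rpow_mul_coord hy i).fderiv]
    refine ContinuousAt.congr ?_ hev.symm
    have hr : ∀ a : ℝ, ContinuousAt (fun y => ‖y - x₀‖ ^ a) x := fun a =>
      (hasFDerivAt_norm_sub_rpow a hx).continuousAt
    have := hr (-(N : ℝ))
    have := hr (-(N : ℝ) - 2)
    simp only [add_apply, smul_apply, smul_eq_mul,
      innerSL_apply_apply]
    fun_prop
  have hparts : ∀ i, ∫ x, φ x * fderiv ℝ (V i) x (EuclideanSpace.single i 1) =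
      - ∫ x, fderiv ℝ φ x (EuclideanSpace.single i 1) * V i x := fun i =>
    integral_mul_fderiv_eq_neg_fderiv_mul_of_integrable (hi i) (hi' i)
      (hcont _ subset_rfl _ hφ.continuous (hVd i))
      (fun x _ => hφ.differentiable one_ne_zero x)
      (fun x hx => (hasFDerivAt_norm_rpow_mul_coord (hne x hx) i).differentiableAt)
  simp only [hdec]
  refine ⟨integrable_finsetSum _ fun i _ => hi i, ?_⟩
  rw [integral_finsetSum _ fun i _ => hi i, ← neg_eq_zero, ← Finset.sum_neg_distrib]
  simp only [← hparts]
  rw [← integral_finsetSum _ fun i _ => hi' i, integral_eq_zero_of_ae]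
  refine Eventually.of_forall fun x => ?_
  simp only [← Finset.mul_sum, Pi.zero_apply]
  by_cases hx : x = x₀
  · rw [hx, image_eq_zero_of_notMem_tsupport hx₀, zero_mul]
  · rw [sum_fderiv_norm_rpow_mul_coord hx, mul_zero]

end Fundamental

/-! ### Weak comparison principle -/

theorem hasDerivAt_max_zero_sq (t : ℝ) :
    HasDerivAt (fun s : ℝ => max s 0 ^ 2) (2 * max t 0) t := by
  rcases lt_trichotomy t 0 with ht | rfl | ht
  · rw [max_eq_right ht.le, mul_zero]
    refine (hasDerivAt_const t (0 : ℝ)).congr_of_eventuallyEq ?_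
    filter_upwards [Iio_mem_nhds ht] with s hs
    simp [max_eq_right (le_of_lt (Set.mem_Iio.1 hs))]
  · rw [hasDerivAt_iff_isLittleO]
    have h : (fun s : ℝ => max s 0 ^ 2) =O[nhds 0] fun s : ℝ => s ^ 2 := by
      refine Asymptotics.IsBigO.of_bound 1 (Eventually.of_forall fun s => ?_)
      rw [one_mul, norm_pow, norm_pow]
      refine pow_le_pow_left₀ (norm_nonneg _) ?_ 2
      rw [Real.norm_of_nonneg (le_max_right _ _)]
      exact max_le (le_abs_self s) (abs_nonneg s)
    simpa using h.trans_isLittleO (Asymptotics.isLittleO_pow_id one_lt_two)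
  · rw [max_eq_left ht.le]
    have h : HasDerivAt (fun s : ℝ => s ^ 2) (2 * t) t := by simpa using hasDerivAt_pow 2 t
    refine h.congr_of_eventuallyEq ?_
    filter_upwards [Ioi_mem_nhds ht] with s hs
    simp [max_eq_left (le_of_lt (Set.mem_Ioi.1 hs))]

theorem contDiff_max_zero_sq : ContDiff ℝ 1 fun s : ℝ => max s 0 ^ 2 := by
  rw [contDiff_one_iff_deriv]
  refine ⟨fun t => (hasDerivAt_max_zero_sq t).differentiableAt, ?_⟩
  rw [funext fun t => (hasDerivAt_max_zero_sq t).deriv]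
  fun_prop

theorem ContDiffOn.contDiff_indicator {E F : Type*} [NormedAddCommGroup E] [NormedSpace ℝ E]
    [NormedAddCommGroup F] [NormedSpace ℝ F] {n : WithTop ℕ∞} {U K : Set E} {ψ : E → F}
    (hψ : ContDiffOn ℝ n ψ U) (hU : IsOpen U) (hK : IsClosed K) (hKU : K ⊆ U)
    (h0 : ∀ x ∈ U, x ∉ K → ψ x = 0) : ContDiff ℝ n (U.indicator ψ) := by
  rw [contDiff_iff_contDiffAt]
  intro x
  by_cases hx : x ∈ U
  · refine (hψ.contDiffAt (hU.mem_nhds hx)).congr_of_eventuallyEq ?_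
    filter_upwards [hU.mem_nhds hx] with y hy using Set.indicator_of_mem hy ψ
  · refine (contDiffAt_const (c := (0 : F))).congr_of_eventuallyEq ?_
    filter_upwards [hK.isOpen_compl.mem_nhds fun h => hx (hKU h)] with y hy
    by_cases hyU : y ∈ U
    · rw [Set.indicator_of_mem hyU, h0 y hyU hy]
    · rw [Set.indicator_of_notMem hyU]

/-- Weak comparison principle for the `p`-Laplacian. -/
theorem pLaplace_weak_comparison {E : Type*} [NormedAddCommGroup E] [InnerProductSpace ℝ E]
    [FiniteDimensional ℝ E] [MeasurableSpace E] [BorelSpace E] {μ : Measure E}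
    [IsFiniteMeasureOnCompacts μ] [μ.IsOpenPosMeasure]
    {p : ℝ} (hp : 1 < p) {U : Set E} (hU : IsOpen U) (hUc : IsCompact (closure U))
    (hUne : U ≠ Set.univ) {u v : E → ℝ} (hu : ContDiff ℝ 1 u) (hv : ContDiffOn ℝ 1 v U)
    (hvc : ContinuousOn v (closure U)) (hbd : ∀ x ∈ frontier U, v x ≤ u x)
    (hsuper : ∀ φ : E → ℝ, ContDiff ℝ 1 φ → HasCompactSupport φ → (∀ x, 0 ≤ φ x) →
      0 ≤ ∫ x, fderiv ℝ φ x (‖gradient u x‖ ^ (p - 2) • gradient u x) ∂μ)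
    (hsub : ∀ φ : E → ℝ, ContDiff ℝ 1 φ → HasCompactSupport φ → (∀ x, 0 ≤ φ x) → tsupport φ ⊆ U →
      Integrable (fun x => fderiv ℝ φ x (‖gradient v x‖ ^ (p - 2) • gradient v x)) μ ∧
      ∫ x, fderiv ℝ φ x (‖gradient v x‖ ^ (p - 2) • gradient v x) ∂μ ≤ 0) :
    ∀ x ∈ U, v x ≤ u x := by
  intro z hz
  refine le_of_forall_pos_le_add fun δ hδ => ?_
  -- The shift `δ` makes `w` negative on the frontier, so its positive part has compact support in
  -- `U`; squaring makes that part `C¹`.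
  set w : E → ℝ := fun x => v x - u x - δ
  set ψ : E → ℝ := fun x => max (w x) 0 ^ 2
  set K : Set E := closure U ∩ w ⁻¹' Set.Ici 0
  have hwc : ContinuousOn w (closure U) :=
    (hvc.sub hu.continuous.continuousOn).sub continuousOn_const
  have hK : IsClosed K := hwc.preimage_isClosed_of_isClosed isClosed_closure isClosed_Ici
  have hKc : IsCompact K := hUc.of_isClosed_subset hK Set.inter_subset_left
  have hKU : K ⊆ U := by
    rintro x ⟨hx, hwx⟩
    by_contra hxU
    have := hbd x ⟨hx, by rwa [hU.interior_eq]⟩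
    have hwx : 0 ≤ v x - u x - δ := hwx
    linarith
  have hψ0 : ∀ x ∈ U, x ∉ K → ψ x = 0 := by
    intro x hx hxK
    have : w x < 0 := by
      by_contra! h
      exact hxK ⟨subset_closure hx, h⟩
    simp [ψ, max_eq_right this.le]
  have hψ : ContDiffOn ℝ 1 ψ U :=
    contDiff_max_zero_sq.comp_contDiffOn ((hv.sub hu.contDiffOn).sub contDiffOn_const)
  set φ := U.indicator ψ
  have hφ : ContDiff ℝ 1 φ := hψ.contDiff_indicator hU hK hKU hψ0
  have hφz : ∀ x ∉ K, φ x = 0 := fun x hx => by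
    by_cases hxU : x ∈ U
    · exact (Set.indicator_of_mem hxU ψ).trans (hψ0 x hxU hx)
    · exact Set.indicator_of_notMem hxU ψ
  have hφK : tsupport φ ⊆ K := closure_minimal (fun x hx => by
    by_contra h
    exact hx (hφz x h)) hK
  have hφc : HasCompactSupport φ := hKc.of_isClosed_subset (isClosed_tsupport _) hφK
  have hφ0 : ∀ x, 0 ≤ φ x := fun x => Set.indicator_nonneg (fun y _ => sq_nonneg _) x
  have hfd : ∀ x ∈ U, ∀ a, fderiv ℝ φ x a =
      2 * max (w x) 0 * inner ℝ a (gradient v x - gradient u x) := by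
    intro x hx a
    have hev : φ =ᶠ[nhds x] ψ := by
      filter_upwards [hU.mem_nhds hx] with y hy using Set.indicator_of_mem hy ψ
    have hvx := ((hv.contDiffAt (hU.mem_nhds hx)).differentiableAt one_ne_zero).hasFDerivAt
    have hux := (hu.differentiable one_ne_zero x).hasFDerivAt
    have h : HasFDerivAt ψ _ x :=
      (hasDerivAt_max_zero_sq (w x)).comp_hasFDerivAt x ((hvx.sub hux).sub_const δ)
    rw [hev.fderiv_eq, h.fderiv, real_inner_comm, inner_sub_left, inner_gradient_left,
      inner_gradient_left]
    simp
  have hfz : ∀ x ∉ K, fderiv ℝ φ x = 0 := fun x hx =>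
    image_eq_zero_of_notMem_tsupport fun h => hx (hφK (tsupport_fderiv_subset ℝ h))
  have hgu : Continuous (gradient u) :=
    (InnerProductSpace.toDual ℝ E).symm.continuous.comp (hu.continuous_fderiv one_ne_zero)
  have hi1 : Integrable
      (fun x => fderiv ℝ φ x (‖gradient u x‖ ^ (p - 2) • gradient u x)) μ := by
    refine ((hφ.continuous_fderiv one_ne_zero).clm_apply
      ((continuous_norm_rpow_smul hp).comp hgu)).integrable_of_hasCompactSupport ?_
    refine (hφc.fderiv ℝ).mono fun x hx hx' => hx ?_
    simp [hx']
  obtain ⟨hi2, hle⟩ := hsub φ hφ hφc hφ0 (hφK.trans hKU)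
  have hge := hsuper φ hφ hφc hφ0
  set I : E → ℝ := fun x => fderiv ℝ φ x (‖gradient v x‖ ^ (p - 2) • gradient v x) -
    fderiv ℝ φ x (‖gradient u x‖ ^ (p - 2) • gradient u x)
  -- As `∇φ` is a nonnegative multiple of `∇v - ∇u`, the difference of the two fluxes tested with
  -- `φ` is a weighted monotonicity expression.
  have hI : ∀ x ∈ U, I x = 2 * max (w x) 0 * inner ℝ (‖gradient v x‖ ^ (p - 2) • gradient v x -
      ‖gradient u x‖ ^ (p - 2) • gradient u x) (gradient v x - gradient u x) := fun x hx => by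
    simp only [I]
    rw [← map_sub, hfd x hx]
  have hIz : ∀ x ∉ U, I x = 0 := fun x hx => by
    simp [I, hfz x fun h => hx (hKU h)]
  have hI0 : 0 ≤ I := fun x => by
    by_cases hx : x ∈ U
    · rw [Pi.zero_apply, hI x hx]
      exact mul_nonneg (by positivity) (inner_norm_rpow_smul_sub_nonneg hp _ _)
    · exact (hIz x hx).ge
  have hIint : ∫ x, I x ∂μ = 0 := by
    refine le_antisymm ?_ (integral_nonneg hI0)
    rw [integral_sub hi2 hi1]
    linarith
  have hae := (integral_eq_zero_iff_of_nonneg hI0 (hi2.sub hi1)).1 hIint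
  -- Where the integrand vanishes, either the weight is zero or the gradients agree; both kill `∇φ`.
  have hfae : fderiv ℝ φ =ᵐ[μ] fun _ => 0 := by
    filter_upwards [hae] with x hx
    by_cases hxU : x ∈ U
    · ext a
      rw [hfd x hxU a]
      rw [hI x hxU] at hx
      rcases mul_eq_zero.1 hx with h | h
      · simp [h]
      · simp [eq_of_inner_norm_rpow_smul_sub_eq_zero hp h]
    · exact hfz x fun h => hxU (hKU h)
  have hf0 := (Continuous.ae_eq_iff_eq μ (hφ.continuous_fderiv one_ne_zero)
    continuous_const).1 hfae
  -- So `φ` is constant, and it vanishes at any point outside `U`.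
  obtain ⟨y, hy⟩ := (Set.ne_univ_iff_exists_notMem U).1 hUne
  have hzy : φ z = φ y :=
    is_const_of_fderiv_eq_zero (hφ.differentiable one_ne_zero) (fun x => congrFun hf0 x) z y
  rw [hφz y fun h => hy (hKU h)] at hzy
  have hzy : max (w z) 0 ^ 2 = 0 := (Set.indicator_of_mem hz ψ).symm.trans hzy
  have hmax : max (w z) 0 = 0 := pow_eq_zero_iff two_ne_zero |>.1 hzy
  have : v z - u z - δ ≤ 0 := max_eq_right_iff.1 hmax
  linarith

/-! ### The radial barrier -/

section Radial

variable {N : ℕ}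

theorem hasGradientAt_radial {c γ b : ℝ} {x x₀ : EuclideanSpace ℝ (Fin N)} (hx : x ≠ x₀) :
    HasGradientAt (fun y => c * (‖y - x₀‖ ^ (-γ) - b))
      ((c * (-γ * ‖x - x₀‖ ^ (-γ - 2))) • (x - x₀)) x := by
  rw [hasGradientAt_iff_hasFDerivAt, map_smul, mul_smul]
  exact ((hasFDerivAt_norm_sub_rpow (-γ) hx).sub_const b).const_mul c

theorem norm_rpow_smul_gradient_radial {p c γ b : ℝ} (hc : 0 < c) (hγ : 0 < γ)
    (hγp : (γ + 1) * (p - 1) = N - 1) {x x₀ : EuclideanSpace ℝ (Fin N)} (hx : x ≠ x₀) :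
    ‖gradient (fun y => c * (‖y - x₀‖ ^ (-γ) - b)) x‖ ^ (p - 2) •
      gradient (fun y => c * (‖y - x₀‖ ^ (-γ) - b)) x =
      (-(c * γ) ^ (p - 1)) • (‖x - x₀‖ ^ (-(N : ℝ)) • (x - x₀)) := by
  have hpos : 0 < ‖x - x₀‖ := norm_pos_iff.2 (sub_ne_zero.2 hx)
  have hcγ : 0 < c * γ := by positivity
  have hn : ‖(c * (-γ * ‖x - x₀‖ ^ (-γ - 2))) • (x - x₀)‖ = c * γ * ‖x - x₀‖ ^ (-γ - 1) := by
    rw [norm_smul, Real.norm_eq_abs, show c * (-γ * ‖x - x₀‖ ^ (-γ - 2)) =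
      -(c * γ * ‖x - x₀‖ ^ (-γ - 2)) by ring, abs_neg, abs_of_nonneg (by positivity), mul_assoc,
      ← Real.rpow_add_one hpos.ne']
    ring_nf
  rw [(hasGradientAt_radial hx).gradient, hn, smul_smul, smul_smul,
    Real.mul_rpow hcγ.le (by positivity), ← Real.rpow_mul hpos.le]
  congr 1
  -- The choice of `γ` is exactly what makes the power of the distance in the flux equal to `-N`.
  rw [show -(N : ℝ) = (-γ - 1) * (p - 2) + (-γ - 2) by linear_combination hγp,
    Real.rpow_add hpos, show p - 1 = (p - 2) + 1 by ring, Real.rpow_add_one hcγ.ne']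
  ring

theorem radial_le_of_pLaplace_supersolution {p γ c r R : ℝ} (hp : 1 < p) (hc : 0 < c) (hγ : 0 < γ)
    (hγp : (γ + 1) * (p - 1) = N - 1) (hr : 0 < r) {x₀ : EuclideanSpace ℝ (Fin N)}
    {u : EuclideanSpace ℝ (Fin N) → ℝ} (hu : ContDiff ℝ 1 u)
    (hsuper : ∀ φ : EuclideanSpace ℝ (Fin N) → ℝ, ContDiff ℝ 1 φ → HasCompactSupport φ →
      (∀ x, 0 ≤ φ x) → 0 ≤ ∫ x, fderiv ℝ φ x (‖gradient u x‖ ^ (p - 2) • gradient u x))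
    (hur : ∀ x, ‖x - x₀‖ = r → c * (r ^ (-γ) - R ^ (-γ)) ≤ u x)
    (huR : ∀ x, ‖x - x₀‖ = R → 0 ≤ u x) {x : EuclideanSpace ℝ (Fin N)}
    (hrx : r < ‖x - x₀‖) (hxR : ‖x - x₀‖ < R) :
    c * (‖x - x₀‖ ^ (-γ) - R ^ (-γ)) ≤ u x := by
  set U : Set (EuclideanSpace ℝ (Fin N)) := {x | r < ‖x - x₀‖ ∧ ‖x - x₀‖ < R}
  have hn : Continuous fun x : EuclideanSpace ℝ (Fin N) => ‖x - x₀‖ := by fun_prop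
  have hU : IsOpen U := (isOpen_lt continuous_const hn).inter (isOpen_lt hn continuous_const)
  have hcl : closure U ⊆ {x | r ≤ ‖x - x₀‖ ∧ ‖x - x₀‖ ≤ R} :=
    closure_minimal (fun x hx => ⟨hx.1.le, hx.2.le⟩)
      ((isClosed_le continuous_const hn).inter (isClosed_le hn continuous_const))
  have hne : ∀ x ∈ closure U, x ≠ x₀ := fun x hx h => by
    have := (hcl hx).1
    rw [h, sub_self, norm_zero] at this
    linarith
  have hd : ∀ x ∈ closure U, ContDiffAt ℝ 1 (fun y => c * (‖y - x₀‖ ^ (-γ) - R ^ (-γ))) x := by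
    intro x hx
    have h0 := sub_ne_zero.2 (hne x hx)
    refine contDiffAt_const.mul (ContDiffAt.sub ?_ contDiffAt_const)
    exact ((contDiffAt_id.sub contDiffAt_const).norm ℝ h0).rpow_const_of_ne (norm_ne_zero_iff.2 h0)
  refine pLaplace_weak_comparison (μ := volume) (v := fun y => c * (‖y - x₀‖ ^ (-γ) - R ^ (-γ)))
    hp hU ?_ ?_ hu (fun x hx => (hd x (subset_closure hx)).contDiffWithinAt)
    (fun x hx => (hd x hx).continuousAt.continuousWithinAt) ?_ hsuper ?_ x ⟨hrx, hxR⟩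
  · refine (isCompact_closedBall x₀ R).of_isClosed_subset isClosed_closure fun x hx => ?_
    rw [mem_closedBall_iff_norm]
    exact (hcl hx).2
  · intro h
    exact hne x₀ (subset_closure (h ▸ Set.mem_univ x₀)) rfl
  · intro x hx
    rw [hU.frontier_eq] at hx
    rcases (hcl hx.1).1.eq_or_lt with h | h
    · rw [← h]
      exact hur x h.symm
    rcases (hcl hx.1).2.eq_or_lt with h' | h'
    · rw [h', sub_self, mul_zero]
      exact huR x h'
    · exact absurd ⟨h, h'⟩ hx.2
  · intro φ hφ hφc _ hφU
    have hx₀ : x₀ ∉ tsupport φ := fun h => hne x₀ (subset_closure (hφU h)) rfl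
    obtain ⟨h1, h2⟩ := integrable_and_integral_fderiv_norm_rpow_smul hφ hφc hx₀
    have e : ∀ x, fderiv ℝ φ x (‖gradient (fun y => c * (‖y - x₀‖ ^ (-γ) - R ^ (-γ))) x‖ ^ (p - 2) •
        gradient (fun y => c * (‖y - x₀‖ ^ (-γ) - R ^ (-γ))) x) =
        -(c * γ) ^ (p - 1) * fderiv ℝ φ x (‖x - x₀‖ ^ (-(N : ℝ)) • (x - x₀)) := by
      intro x
      by_cases hx : x ∈ tsupport φ
      · rw [norm_rpow_smul_gradient_radial hc hγ hγp (hne x (subset_closure (hφU hx))), map_smul,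
          smul_eq_mul]
      · have : fderiv ℝ φ x = 0 :=
          image_eq_zero_of_notMem_tsupport fun h => hx (tsupport_fderiv_subset ℝ h)
        simp [this]
    simp only [e]
    refine ⟨h1.const_mul _, ?_⟩
    rw [integral_const_mul, h2, mul_zero]

end Radial

/-! ### Lower bound at infinity -/

section Decay

variable {N : ℕ}

theorem IsWeakSolutionPLaplace.integral_fderiv_nonneg {p : ℝ} (hp : 1 < p)
    {u F : EuclideanSpace ℝ (Fin N) → ℝ} (h : IsWeakSolutionPLaplace p u F)
    (hu : ContDiff ℝ 1 u) (hF : ∀ x, 0 ≤ F x) {φ : EuclideanSpace ℝ (Fin N) → ℝ}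
    (hφ : ContDiff ℝ 1 φ) (hφc : HasCompactSupport φ) (hφ0 : ∀ x, 0 ≤ φ x) :
    0 ≤ ∫ x, fderiv ℝ φ x (‖gradient u x‖ ^ (p - 2) • gradient u x) := by
  obtain ⟨G, hG, -, hsol⟩ := h
  have hgu : Continuous (gradient u) :=
    (InnerProductSpace.toDual ℝ _).symm.continuous.comp (hu.continuous_fderiv one_ne_zero)
  refine integral_fderiv_nonneg_of_forall_contDiff
    ((continuous_norm_rpow_smul hp).comp hgu) (fun χ hχ hχc hχ0 => ?_) hφ hφc hφ0
  have e : ∫ x, fderiv ℝ χ x (‖gradient u x‖ ^ (p - 2) • gradient u x) =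
      ∫ x, ‖G x‖ ^ (p - 2) * inner ℝ (G x) (gradient χ x) := by
    refine integral_congr_ae ?_
    filter_upwards [hG.ae_eq_gradient hu] with x hx
    rw [hx, map_smul, smul_eq_mul, real_inner_comm, inner_gradient_left]
  rw [Function.comp_def, e, hsol χ ⟨hχ, hχc⟩]
  exact integral_nonneg fun x => mul_nonneg (hF x) (hχ0 x)

/-- A nonnegative `p`-superharmonic function that is positive somewhere decays at infinity no
faster than the fundamental solution. -/
theorem exists_pos_mul_norm_sub_rpow_le {p γ : ℝ} (hp : 1 < p) (hγ : 0 < γ)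
    (hγp : (γ + 1) * (p - 1) = N - 1) {u : EuclideanSpace ℝ (Fin N) → ℝ} (hu : ContDiff ℝ 1 u)
    (hu0 : ∀ x, 0 ≤ u x)
    (hsuper : ∀ φ : EuclideanSpace ℝ (Fin N) → ℝ, ContDiff ℝ 1 φ → HasCompactSupport φ →
      (∀ x, 0 ≤ φ x) → 0 ≤ ∫ x, fderiv ℝ φ x (‖gradient u x‖ ^ (p - 2) • gradient u x))
    {x₀ : EuclideanSpace ℝ (Fin N)} (hx₀ : 0 < u x₀) :
    ∃ c > 0, ∃ r > 0, ∀ x, r < ‖x - x₀‖ → c * ‖x - x₀‖ ^ (-γ) ≤ u x := by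
  have hev : ∀ᶠ x in nhds x₀, u x₀ / 2 < u x :=
    hu.continuous.continuousAt.eventually (lt_mem_nhds (half_lt_self hx₀))
  obtain ⟨r, hr, hball⟩ := Metric.nhds_basis_closedBall.eventually_iff.1 hev
  -- Normalised so that `c * r ^ (-γ) = u x₀ / 2`, a lower bound for `u` on the sphere of radius
  -- `r`. Being independent of `R`, it survives the limit.
  set c := u x₀ / 2 * r ^ γ
  have hc : 0 < c := by positivity
  refine ⟨c, hc, r, hr, fun x hx => ?_⟩
  have hlim : Tendsto (fun R : ℝ => c * (‖x - x₀‖ ^ (-γ) - R ^ (-γ))) atTop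
      (nhds (c * (‖x - x₀‖ ^ (-γ) - 0))) :=
    (tendsto_const_nhds.sub (tendsto_rpow_neg_atTop hγ)).const_mul c
  rw [sub_zero] at hlim
  refine le_of_tendsto hlim ?_
  filter_upwards [eventually_gt_atTop ‖x - x₀‖] with R hR
  refine radial_le_of_pLaplace_supersolution hp hc hγ hγp hr hu hsuper (fun y hy => ?_)
    (fun y _ => hu0 y) hx hR
  have hR0 : 0 ≤ R := (norm_nonneg _).trans hR.le
  calc c * (r ^ (-γ) - R ^ (-γ)) ≤ c * r ^ (-γ) :=
        mul_le_mul_of_nonneg_left (sub_le_self _ (Real.rpow_nonneg hR0 _)) hc.le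
    _ = u x₀ / 2 := by
        rw [mul_assoc, ← Real.rpow_add hr, add_neg_cancel, Real.rpow_zero, mul_one]
    _ ≤ u y := (hball (mem_closedBall_iff_norm.2 hy.le)).le

end Decay

/-! ### Conclusion -/

theorem proposition1p2 (N : ℕ) (p : ℝ) (hp : 1 < p) (hpN : p < N)
    (α : ℝ≥0) (hα : 0 < α) (hα1 : α ≤ 1)
    (g : EuclideanSpace ℝ (Fin N) → ℝ) (hg : Continuous g) (hgpos : ∀ x, 0 < g x)
    (f : ℝ → ℝ) (hf : ContinuousOn f (Set.Ici 0)) (hf0 : f 0 = 0) (hfpos : ∀ t, 0 < t → 0 < f t)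
    (u : EuclideanSpace ℝ (Fin N) → ℝ) (huD : MemD1p p u) (huC : MemC1alphaLoc α u)
    (hu0 : ∀ x, 0 ≤ u x)
    (hsol : IsWeakSolutionPLaplace p u (fun x => g x * f (u x)))
    (hlim : liminf (fun x : EuclideanSpace ℝ (Fin N) =>
        ((‖x‖ ^ (((N : ℝ) - p) / (p - 1)) * u x : ℝ) : EReal))
      (Bornology.cobounded (EuclideanSpace ℝ (Fin N))) = 0) :
    ∀ x, u x = 0 := by
  set γ := ((N : ℝ) - p) / (p - 1)
  have hp1 : 0 < p - 1 := by linarith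
  have hγ : 0 < γ := div_pos (by linarith) hp1
  have hγp : (γ + 1) * (p - 1) = N - 1 := by
    rw [add_mul, div_mul_cancel₀ _ hp1.ne']
    ring
  have hF : ∀ x, 0 ≤ g x * f (u x) := fun x => by
    refine mul_nonneg (hgpos x).le ?_
    rcases (hu0 x).eq_or_lt with h | h
    · rw [← h, hf0]
    · exact (hfpos _ h).le
  by_contra! ⟨x₀, hx₀⟩
  obtain ⟨c, hc, r, hr, hle⟩ := exists_pos_mul_norm_sub_rpow_le hp hγ hγp huC.1 hu0
    (fun φ => hsol.integral_fderiv_nonneg hp huC.1 hF) ((hu0 x₀).lt_of_ne' hx₀)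
  -- Moving the centre from `x₀` to the origin costs the factor `2 ^ (-γ)`, since `‖x - x₀‖ ≤ 2 *
  -- ‖x‖` far out.
  have hev : ∀ᶠ x in Bornology.cobounded (EuclideanSpace ℝ (Fin N)),
      ((c * 2 ^ (-γ) : ℝ) : EReal) ≤ ((‖x‖ ^ γ * u x : ℝ) : EReal) := by
    filter_upwards [tendsto_norm_cobounded_atTop.eventually_gt_atTop (‖x₀‖ + r)] with x hx
    rw [EReal.coe_le_coe_iff]
    have h1 : r < ‖x - x₀‖ := by linarith [norm_sub_norm_le x x₀]
    have h2 : ‖x - x₀‖ ≤ 2 * ‖x‖ := by linarith [norm_sub_le x x₀]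
    have hx0 : 0 < ‖x‖ := by linarith [norm_nonneg x₀]
    have h3 : (2 * ‖x‖) ^ (-γ) ≤ ‖x - x₀‖ ^ (-γ) :=
      Real.rpow_le_rpow_of_nonpos (hr.trans h1) h2 (by linarith)
    calc c * 2 ^ (-γ) = ‖x‖ ^ γ * (c * (2 * ‖x‖) ^ (-γ)) := by
          rw [Real.mul_rpow two_pos.le hx0.le, Real.rpow_neg hx0.le]
          field_simp
      _ ≤ ‖x‖ ^ γ * u x := by
          refine mul_le_mul_of_nonneg_left (le_trans ?_ (hle x h1)) (by positivity)
          exact mul_le_mul_of_nonneg_left h3 hc.le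
  have hle0 := le_liminf_of_le (by isBoundedDefault) hev
  rw [hlim, ← EReal.coe_zero, EReal.coe_le_coe_iff] at hle0
  have : 0 < c * 2 ^ (-γ) := by positivity
  linarith
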